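/- **Setting.** Let $\mathbb{R}^{3,1}$ be $\mathbb{R}^4$ with the symmetric bilinear form $(\cdot,\cdot)$ of signature $(-+++)$, let $\mathcal{L}=\{X : (X,X)=0\}$ be its lightcone, let $\mathbb{P}(\mathcal{L})$ be the projective lightcone (the conformal $2$-sphere), and let $(x\wedge y)v=(x,v)y-(y,v)x$. A *polarised curve* $L:(\mathbb{R},q)\to\mathbb{P}(\mathcal{L})$ is a smooth regular curve $L=\langle X\rangle$ together with a smooth nowhere vanishing quadratic differential $q=q(s)\,ds^2$; it is *closed* with period $T>0$ if $L$ and $q$ are $T$-periodic. Put $$\eta = q\,\frac{X\wedge dX}{(dX,dX)},$$ which does not depend on the choice of the nowhere vanishing lift $X$ of $L$. For $\mu\in\mathbb{R}$ let $A^\mu$ be the solution of $dA^\mu=-\mu\,\eta A^\mu$, $A^\mu(0)=\mathrm{id}$. The *monodromy matrix* is $\mathcal{M}^\mu=A^\mu(T)$, and on the $\ell$-fold cover of $L$ it is $A^\mu(\ell T)$. A closed polarised curve is of *finite type* if $\mathcal{M}^\mu$ fails to be diagonalisable (over $\mathbb{C}$) for only finitely many $\mu\in\mathbb{R}$. A *resonance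 point* is a real $\mu\neq 0$ whose monodromy matrix is diagonalisable with the single eigenvalue $1$ of multiplicity $4$. For $\mathfrak{q}\in\mathbb{R}^{3,1}$ with $(\mathfrak{q},\mathfrak{q})=-\kappa$, the surface $M=\{X\in\mathcal{L} : (X,\mathfrak{q})=-1\}$ with the induced metric is a space form of sectional curvature $\kappa$. A smooth regular closed curve in $M$ is *constrained elastic* if it is a critical point of the bending energy $\int k^2\,d\sigma$ ($k$ the geodesic curvature, $\sigma$ the arc-length) under all smooth variations through regular closed curves in $M$ that fix length and enclosed area. (Enclosed area is fixed when the signed area swept out by the variation vanishes.) **Corollary 4.3.** Let $L:(\mathbb{R},q)\to\mathbb{P}(\mathcal{L})$ be a closed polarised curve of finite type with period $T$. Suppose that, for some $\kappa\in\mathbb{R}$ and some $\mathfrak{q}$ with $(\mathfrak{q},\mathfrak{q})=-\kappa$, the curve $L$ has a lift $X$ with values in $M$ that is a constrained elastic curve in $M$, and that $L$ is polarised by the arc-length of $X$ in this space form, that is, $q=(dX,dX)$. Then there are $\ell\in\mathbb{N}$, $\ell\ge 1$, and a real number $$\mu>-\frac{\kappa}{2},\qquad \mu\neq 0,$$ such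 that $\mu$ is a resonance point of $L$ on its $\ell$-fold cover. -/

import Mathlib

open scoped ContDiff

noncomputable section

namespace LightconeModel

/-! ## Minkowski space, the lightcone and the conformal 2-sphere -/

/-- The vector space underlying Minkowski space `ℝ^{3,1}`. -/
abbrev V : Type := Fin 4 → ℝ

/-- Gram matrix of the symmetric bilinear form of signature `(- + + +)`. -/
def gram : Matrix (Fin 4) (Fin 4) ℝ := Matrix.diagonal ![-1, 1, 1, 1]

/-- The symmetric bilinear form of signature `(- + + +)`. -/
def ip (x y : V) : ℝ := dotProduct (gram.mulVec x) y

theorem ip_eq (x y : V) :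
    ip x y = -(x 0 * y 0) + x 1 * y 1 + x 2 * y 2 + x 3 * y 3 := by
  simp [ip, gram, dotProduct, Fin.sum_univ_four, Matrix.mulVec_diagonal]

/-- The matrix of the skew endomorphism `x ∧ y`. -/
def wedge (x y : V) : Matrix (Fin 4) (Fin 4) ℝ :=
  Matrix.vecMulVec y (gram.mulVec x) - Matrix.vecMulVec x (gram.mulVec y)

theorem wedge_mulVec (x y v : V) :
    (wedge x y).mulVec v = ip x v • y - ip y v • x := by
  funext i
  simp only [wedge, ip, Matrix.mulVec, Matrix.vecMulVec, dotProduct, Fin.sum_univ_four,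
    Matrix.sub_apply, Matrix.of_apply, Pi.sub_apply, Pi.smul_apply, smul_eq_mul]
  ring

/-- The lightcone. -/
def lightcone : Set V := {X | ip X X = 0}

/-- The projective lightcone `ℙ(𝓛)`, that is, the conformal 2-sphere. -/
def ConformalSphere : Type :=
  {l : Projectivization ℝ V // ∀ X ∈ l.submodule, X ∈ lightcone}

/-- A smooth nowhere vanishing section of the line bundle `L` over `ℝ`. -/
structure IsLift (L : ℝ → ConformalSphere) (X : ℝ → V) : Prop where
  smooth : ContDiff ℝ ∞ X
  ne_zero : ∀ s, X s ≠ 0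
  mem : ∀ s, X s ∈ (L s).1.submodule

/-! ## Polarised curves, connections, monodromy -/

/-- A smooth regular curve `L` in the conformal 2-sphere, with domain the universal cover `ℝ`
of the parameter circle, together with a smooth non-vanishing quadratic differential
`q s ds²`. -/
structure PolarisedCurve where
  /-- the curve -/
  L : ℝ → ConformalSphere
  /-- the coefficient of the quadratic differential -/
  q : ℝ → ℝ
  regular : ∃ X, IsLift L X ∧ ∀ s, 0 < ip (deriv X s) (deriv X s)
  q_smooth : ContDiff ℝ ∞ q
  q_ne_zero : ∀ s, q s ≠ 0

namespace PolarisedCurve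

/-- The curve together with its polarisation is closed, with period `T`. -/
def IsClosedWithPeriod (Λ : PolarisedCurve) (T : ℝ) : Prop :=
  (∀ s, Λ.L (s + T) = Λ.L s) ∧ ∀ s, Λ.q (s + T) = Λ.q s

/-- `η = q (X ∧ dX) / (dX, dX)`, written in terms of a lift `X` as a matrix-valued coefficient
of `ds`. By `eta_eq` below it does not depend on the lift. -/
def eta (Λ : PolarisedCurve) (X : ℝ → V) (s : ℝ) : Matrix (Fin 4) (Fin 4) ℝ :=
  (Λ.q s / ip (deriv X s) (deriv X s)) • wedge (X s) (deriv X s)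

/-- `M` is the monodromy matrix over the period `T` with spectral parameter `μ`:
`M = A T`, where `A' = -μ η A` and `A 0 = id`. -/
def IsMonodromy (Λ : PolarisedCurve) (T μ : ℝ) (M : Matrix (Fin 4) (Fin 4) ℝ) : Prop :=
  ∃ X, IsLift Λ.L X ∧ ∃ A : ℝ → Matrix (Fin 4) (Fin 4) ℝ,
    A 0 = 1 ∧
    (∀ s i j, HasDerivAt (fun r => A r i j) ((-μ • (Λ.eta X s * A s)) i j) s) ∧
    A T = M

end PolarisedCurve

/-- Diagonalisability over the complex numbers. -/
def IsDiagonalisable (M : Matrix (Fin 4) (Fin 4) ℝ) : Prop :=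
  ∃ (P : Matrix (Fin 4) (Fin 4) ℂ) (d : Fin 4 → ℂ),
    IsUnit P ∧ M.map Complex.ofReal * P = P * Matrix.diagonal d

namespace PolarisedCurve

/-- Finite type: the monodromy matrix is diagonalisable for all but finitely many real
spectral parameters. -/
def IsFiniteType (Λ : PolarisedCurve) (T : ℝ) : Prop :=
  {μ : ℝ | ∃ M, Λ.IsMonodromy T μ M ∧ ¬ IsDiagonalisable M}.Finite

/-- `μ` is a resonance point of the curve regarded as a closed curve of period `T`: a spectral
parameter of Darboux transforms (hence non-zero; for `μ = 0` the monodromy is always trivial)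
whose monodromy matrix is diagonalisable with the single eigenvalue `1` of multiplicity `4`. -/
def IsResonancePoint (Λ : PolarisedCurve) (T μ : ℝ) : Prop :=
  μ ≠ 0 ∧ ∃ M, Λ.IsMonodromy T μ M ∧ IsDiagonalisable M ∧
    M.charpoly = (Polynomial.X - Polynomial.C 1) ^ 4

end PolarisedCurve

/-! ## Space forms and constrained elastic curves -/

/-- The space form determined by the vector `p`; with the metric induced by `ip`, it has constant
sectional curvature `-(p, p)`. -/
def spaceForm (p : V) : Set V := {X | X ∈ lightcone ∧ ip X p = -1}

/-- A smooth regular closed curve of period `T` in the space form of `p`. -/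
structure IsClosedCurveIn (p : V) (T : ℝ) (γ : ℝ → V) : Prop where
  smooth : ContDiff ℝ ∞ γ
  mem : ∀ s, γ s ∈ spaceForm p
  periodic : ∀ s, γ (s + T) = γ s
  regular : ∀ s, 0 < ip (deriv γ s) (deriv γ s)

/-- Speed of a curve. -/
def speed (γ : ℝ → V) (s : ℝ) : ℝ := Real.sqrt (ip (deriv γ s) (deriv γ s))

/-- Unit tangent field of a curve. -/
def unitTangent (γ : ℝ → V) (s : ℝ) : V := (speed γ s)⁻¹ • deriv γ s

/-- For `X` in the space form of `p`, the orthogonal projection onto the tangent space at `X`,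
which is the orthogonal complement of `X` and `p`. -/
def tangentProj (p X v : V) : V :=
  v + (ip v p + ip p p * ip v X) • X + ip v X • p

theorem tangentProj_spec (p X v : V) (hX : X ∈ spaceForm p) :
    ip (tangentProj p X v) X = 0 ∧ ip (tangentProj p X v) p = 0 ∧
      (ip v X = 0 → ip v p = 0 → tangentProj p X v = v) := by
  obtain ⟨h0, h1⟩ := hX
  have h0' : ip X X = 0 := h0
  have e1 : ∀ a b c d : V, ∀ r t : ℝ,
      ip (a + r • b + t • c) d = ip a d + r * ip b d + t * ip c d := by
    intro a b c d r t
    simp only [ip_eq, Pi.add_apply, Pi.smul_apply, smul_eq_mul]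
    ring
  have h2 : ip p X = -1 := by
    rw [← h1]
    simp only [ip_eq]
    ring
  refine ⟨?_, ?_, ?_⟩
  · rw [tangentProj, e1, h0', h2]
    ring
  · rw [tangentProj, e1, h1]
    ring
  · intro h3 h4
    simp [tangentProj, h3, h4]

/-- The curvature vector `∇_σ τ` (arc-length derivative of the unit tangent `τ`, for the
Levi-Civita connection of the space form), whose norm is the absolute geodesic curvature. -/
def curvatureVector (p : V) (γ : ℝ → V) (s : ℝ) : V :=
  tangentProj p (γ s) ((speed γ s)⁻¹ • deriv (unitTangent γ) s)

/-- Bending energy: the integral of the squared geodesic curvature over one period, with respect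
to arc-length. -/
def bendingEnergy (p : V) (T : ℝ) (γ : ℝ → V) : ℝ :=
  ∫ s in (0 : ℝ)..T, ip (curvatureVector p γ s) (curvatureVector p γ s) * speed γ s

/-- Length of one period. -/
def length (T : ℝ) (γ : ℝ → V) : ℝ := ∫ s in (0 : ℝ)..T, speed γ s

/-- The area form of the space form of `p` at `X`. -/
def areaForm (p X u v : V) : ℝ := Matrix.det ![X, p, u, v]

/-- The signed area swept out by the closed curves `Γ e`, for `e` from `0` to `ε`, which is the
difference of the signed areas enclosed by `Γ ε` and by `Γ 0`. -/
def sweptArea (p : V) (T : ℝ) (Γ : ℝ → ℝ → V) (ε : ℝ) : ℝ :=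
  ∫ e in (0 : ℝ)..ε, ∫ s in (0 : ℝ)..T,
    areaForm p (Γ e s) (deriv (fun r => Γ r s) e) (deriv (Γ e) s)

/-- A smooth variation of `γ` through regular closed curves in the space form of `p` that fixes
length and enclosed area. -/
structure IsConstrainedVariation (p : V) (T : ℝ) (γ : ℝ → V) (Γ : ℝ → ℝ → V) : Prop where
  smooth : ContDiff ℝ ∞ (fun z : ℝ × ℝ => Γ z.1 z.2)
  curve : ∀ ε, IsClosedCurveIn p T (Γ ε)
  initial : Γ 0 = γ
  length_eq : ∀ ε, length T (Γ ε) = length T γ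
  area_eq : ∀ ε, sweptArea p T Γ ε = 0

/-- A closed constrained elastic curve in the space form of `p`: a critical point of the bending
energy under variations that fix length and enclosed area. -/
def IsConstrainedElastic (p : V) (T : ℝ) (γ : ℝ → V) : Prop :=
  IsClosedCurveIn p T γ ∧
    ∀ Γ, IsConstrainedVariation p T γ Γ →
      HasDerivAt (fun ε => bendingEnergy p T (Γ ε)) 0 0

/-! ## Independence of the lift -/

theorem PolarisedCurve.eta_eq (Λ : PolarisedCurve) (X Y : ℝ → V)
    (hX : IsLift Λ.L X) (hY : IsLift Λ.L Y) (s : ℝ) : Λ.eta X s = Λ.eta Y s := by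
  have hdX : HasDerivAt X (deriv X s) s :=
    (hX.smooth.differentiable (by simp) s).hasDerivAt
  have hdY : HasDerivAt Y (deriv Y s) s :=
    (hY.smooth.differentiable (by simp) s).hasDerivAt
  have hXi : ∀ r i, ∃ a : ℝ, Y r = a • X r ∧ (X r i ≠ 0 → a = Y r i / X r i) := by
    intro r i
    obtain ⟨b, hb⟩ := Submodule.mem_span_singleton.1
      (by simpa [Projectivization.submodule_eq] using hX.mem r)
    obtain ⟨c, hc⟩ := Submodule.mem_span_singleton.1
      (by simpa [Projectivization.submodule_eq] using hY.mem r)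
    have hb0 : b ≠ 0 := by
      rintro rfl
      exact hX.ne_zero r (by rw [← hb, zero_smul])
    have key : Y r = (c / b) • X r := by
      rw [← hb, ← hc, smul_smul, div_mul_cancel₀ _ hb0]
    refine ⟨c / b, key, fun hi => ?_⟩
    rw [eq_div_iff hi, key]
    simp
  obtain ⟨i, hi⟩ := Function.ne_iff.1 (hX.ne_zero s)
  have hi' : X s i ≠ 0 := hi
  have hdXi := hasDerivAt_pi.1 hdX i
  have hdYi := hasDerivAt_pi.1 hdY i
  have hα := hdYi.div hdXi hi'
  set α : ℝ → ℝ := (fun r => Y r i) / (fun r => X r i) with hαdef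
  have hev : Y =ᶠ[nhds s] fun r => α r • X r := by
    filter_upwards [hdXi.continuousAt.eventually_ne hi'] with r hr
    obtain ⟨a, ha, ha'⟩ := hXi r i
    rw [ha, ha' hr]
    rfl
  have hY' := (hα.smul hdX).congr_of_eventuallyEq hev |>.deriv
  have hYs : Y s = α s • X s := hev.eq_of_nhds
  have hα0 : α s ≠ 0 := by
    intro h
    exact hY.ne_zero s (by rw [hYs, h, zero_smul])
  have hnull : ∀ r, ip (X r) (X r) = 0 := fun r => (Λ.L r).2 _ (hX.mem r)
  have horth : ip (X s) (deriv X s) = 0 := by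
    have h1 : HasDerivAt (fun r => ip (X r) (X r)) (2 * ip (X s) (deriv X s)) s := by
      have h := hasDerivAt_pi.1 hdX
      have h2 := ((((h 0).mul (h 0)).neg.add ((h 1).mul (h 1))).add
        ((h 2).mul (h 2))).add ((h 3).mul (h 3))
      refine (h2.congr_deriv ?_).congr_of_eventuallyEq (Filter.Eventually.of_forall ?_)
      · rw [ip_eq]
        ring
      · intro r
        simp [ip_eq]
    have h3 : HasDerivAt (fun r => ip (X r) (X r)) 0 s := by
      simp only [hnull]
      exact hasDerivAt_const s 0
    have := h1.unique h3
    linarith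
  generalize hB : deriv Y s = B at *
  generalize hD : deriv X s = D at *
  obtain ⟨b, hb⟩ : ∃ b : ℝ, B = α s • D + b • X s := ⟨_, hY'⟩
  have hn := hnull s
  have hip : ip B B = α s ^ 2 * ip D D := by
    have : ip B B = α s ^ 2 * ip D D + 2 * (α s * b) * ip (X s) D + b ^ 2 * ip (X s) (X s) := by
      rw [hb]
      simp only [ip_eq, Pi.add_apply, Pi.smul_apply, smul_eq_mul]
      ring
    rw [this, hn, horth]
    ring
  have hw : wedge (Y s) B = α s ^ 2 • wedge (X s) D := by
    rw [hYs, hb]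
    ext j k
    simp only [wedge, Matrix.vecMulVec, gram, Matrix.mulVec_diagonal, Matrix.sub_apply,
      Matrix.of_apply, Matrix.smul_apply, Pi.add_apply, Pi.smul_apply, smul_eq_mul]
    ring
  have h2 : α s ^ 2 ≠ 0 := pow_ne_zero 2 hα0
  simp only [eta, hB, hD]
  rw [hip, hw, smul_smul]
  congr 1
  rw [mul_comm (α s ^ 2), ← div_div, div_mul_cancel₀ _ h2]

end LightconeModel

end

/-! For a lift `X` into the space form of `p` whose arc-length is the polarisation, `p + μ X` is
parallel for the connection `d + μ η`, and it is timelike exactly when `μ > -κ / 2`. For such `μ`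
the monodromy matrix therefore lies in `SO(3,1)` and fixes a timelike vector, so it is conjugate
into `SO(4)` with eigenvalues `1, 1, e^{iθ}, e^{-iθ}`, and it has finite order as soon as
`θ ∈ 2πℚ`. Its trace `2 + 2 cos θ` is a real-analytic function of `μ`, equal to `4` at `μ = 0`.
On the ray `μ > max (-κ / 2) 0` this function either is constantly `4`, so that `θ = 0`, or takes
an interval of values, so that `θ` is a rational multiple of `2π` somewhere. On a suitable
multiple cover the monodromy is then trivial. -/

theorem exists_norm_le_of_continuous {F : Type*} [SeminormedAddGroup F] {f : ℝ → F}
    (hf : Continuous f) (ρ : ℝ) : ∃ C, ∀ r, |r| ≤ ρ → ‖f r‖ ≤ C := by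
  obtain ⟨C, hC⟩ := isCompact_Icc.exists_bound_of_continuousOn (s := Set.Icc (-ρ) ρ)
    hf.continuousOn
  exact ⟨C, fun r hr => hC r (abs_le.1 hr)⟩

section PeanoBaker

open scoped Nat

variable {R : Type*} [NormedRing R] [NormedAlgebra ℝ R]

/-- The terms `∫_{0 ≤ rₙ ≤ ⋯ ≤ r₁ ≤ s} E r₁ ⋯ E rₙ` of the Peano–Baker series of `E`. -/
noncomputable def peanoBakerTerm (E : ℝ → R) : ℕ → ℝ → R
  | 0, _ => 1
  | n + 1, s => ∫ r in (0 : ℝ)..s, E r * peanoBakerTerm E n r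

/-- The Peano–Baker series of `E`, also known as its path-ordered exponential: the solution of
`A' = E A`, `A 0 = 1`. -/
noncomputable def peanoBaker (E : ℝ → R) (s : ℝ) : R := ∑' n, peanoBakerTerm E n s

theorem peanoBaker_zero_right (E : ℝ → R) : peanoBaker E 0 = 1 := by
  rw [peanoBaker, tsum_eq_single 0]
  · rfl
  · rintro (_ | n) hn
    · exact absurd rfl hn
    · exact intervalIntegral.integral_same

theorem peanoBakerTerm_smul (E : ℝ → R) (μ : ℝ) (n : ℕ) (s : ℝ) :
    peanoBakerTerm (μ • E) n s = μ ^ n • peanoBakerTerm E n s := by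
  induction n generalizing s with
  | zero => simp [peanoBakerTerm]
  | succ n ih =>
    simp only [peanoBakerTerm, ih, Pi.smul_apply, smul_mul_smul_comm, ← pow_succ']
    exact intervalIntegral.integral_smul _ _

theorem peanoBaker_smul (E : ℝ → R) (μ s : ℝ) :
    peanoBaker (μ • E) s = ∑' n, μ ^ n • peanoBakerTerm E n s := by
  simp only [peanoBaker, peanoBakerTerm_smul]

theorem peanoBaker_zero_left (s : ℝ) : peanoBaker (0 : ℝ → R) s = 1 := by
  rw [← zero_smul ℝ (0 : ℝ → R), peanoBaker_smul, tsum_eq_single 0]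
  · simp [peanoBakerTerm]
  · simp +contextual

theorem norm_peanoBakerTerm_le {E : ℝ → R} {C ρ s : ℝ} (hC : ∀ r, |r| ≤ ρ → ‖E r‖ ≤ C)
    (hs : |s| ≤ ρ) (n : ℕ) :
    ‖peanoBakerTerm E n s‖ ≤ ‖(1 : R)‖ * ((C * |s|) ^ n / n !) := by
  induction n generalizing s with
  | zero => simp [peanoBakerTerm]
  | succ n ih =>
    have hsub : ∀ r ∈ Set.uIoc 0 s, |r| ≤ ρ := fun r hr => by
      simpa using (Set.abs_sub_left_of_mem_uIcc (Set.uIoc_subset_uIcc hr)).trans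
        ((sub_zero s).symm ▸ hs)
    have hcont : Continuous fun r : ℝ => ‖(1 : R)‖ * (C ^ (n + 1) / n !) * |r - 0| ^ n := by
      fun_prop
    calc ‖peanoBakerTerm E (n + 1) s‖
        ≤ ∫ r in Set.uIoc 0 s, ‖E r * peanoBakerTerm E n r‖ :=
          intervalIntegral.norm_integral_le_integral_norm_uIoc
      _ ≤ ∫ r in Set.uIoc 0 s, ‖(1 : R)‖ * (C ^ (n + 1) / n !) * |r - 0| ^ n := by
          refine MeasureTheory.integral_mono_of_nonneg (.of_forall fun r => norm_nonneg _)
            (intervalIntegrable_iff.1 (hcont.intervalIntegrable 0 s))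
            ((MeasureTheory.ae_restrict_iff' measurableSet_uIoc).2 (.of_forall fun r hr => ?_))
          have hEr := hC r (hsub r hr)
          calc ‖E r * peanoBakerTerm E n r‖ ≤ ‖E r‖ * ‖peanoBakerTerm E n r‖ := norm_mul_le _ _
            _ ≤ C * (‖(1 : R)‖ * ((C * |r|) ^ n / n !)) :=
              mul_le_mul hEr (ih (hsub r hr)) (norm_nonneg _) ((norm_nonneg _).trans hEr)
            _ = ‖(1 : R)‖ * (C ^ (n + 1) / n !) * |r - 0| ^ n := by
              rw [sub_zero, mul_pow]
              ring
      _ = ‖(1 : R)‖ * ((C * |s|) ^ (n + 1) / (n + 1)!) := by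
          rw [MeasureTheory.integral_const_mul, integral_pow_abs_sub_uIoc, sub_zero,
            Nat.factorial_succ, mul_pow]
          push_cast
          field_simp

variable {E : ℝ → R}

theorem summable_norm_peanoBakerTerm (hE : Continuous E) (s : ℝ) :
    Summable fun n => ‖peanoBakerTerm E n s‖ := by
  obtain ⟨C, hC⟩ := exists_norm_le_of_continuous hE |s|
  exact ((Real.summable_pow_div_factorial (C * |s|)).mul_left ‖(1 : R)‖).of_nonneg_of_le
    (fun _ => norm_nonneg _) fun n => norm_peanoBakerTerm_le hC le_rfl n

theorem continuous_peanoBakerTerm (hE : Continuous E) (n : ℕ) :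
    Continuous (peanoBakerTerm E n) := by
  induction n with
  | zero => exact continuous_const
  | succ n ih =>
    exact intervalIntegral.continuous_primitive
      (fun a b => (hE.mul ih).intervalIntegrable a b) 0

variable [CompleteSpace R]

theorem hasDerivAt_peanoBakerTerm_succ (hE : Continuous E) (n : ℕ) (s : ℝ) :
    HasDerivAt (peanoBakerTerm E (n + 1)) (E s * peanoBakerTerm E n s) s :=
  (hE.mul (continuous_peanoBakerTerm hE n)).integral_hasStrictDerivAt 0 s |>.hasDerivAt

theorem hasDerivAt_peanoBaker (hE : Continuous E) (s : ℝ) :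
    HasDerivAt (peanoBaker E) (E s * peanoBaker E s) s := by
  have hsum := fun r => (summable_norm_peanoBakerTerm hE r).of_norm
  have hsplit : peanoBaker E = fun r => 1 + ∑' n, peanoBakerTerm E (n + 1) r :=
    funext fun r => (hsum r).tsum_eq_zero_add
  have hderiv : E s * peanoBaker E s = ∑' n, E s * peanoBakerTerm E n s :=
    ((hsum s).tsum_mul_left (E s)).symm
  obtain ⟨C, hC⟩ := exists_norm_le_of_continuous hE (|s| + 1)
  rw [hderiv, hsplit]
  refine (hasDerivAt_tsum_of_isPreconnected
    (((Real.summable_pow_div_factorial (C * (|s| + 1))).mul_left ‖(1 : R)‖).mul_left C)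
    Metric.isOpen_ball (convex_ball (0 : ℝ) (|s| + 1)).isPreconnected
    (fun n r _ => hasDerivAt_peanoBakerTerm_succ hE n r) (fun n r hr => ?_)
    (Metric.mem_ball_self (by positivity)) ((summable_nat_add_iff 1).2 (hsum 0))
    (by simp)).const_add 1
  have hr : |r| ≤ |s| + 1 := (mem_ball_zero_iff.1 hr).le
  have hC0 : 0 ≤ C := (norm_nonneg _).trans (hC r hr)
  refine (norm_mul_le _ _).trans (mul_le_mul (hC r hr) ?_ (norm_nonneg _) hC0)
  refine (norm_peanoBakerTerm_le hC hr n).trans ?_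
  gcongr

end PeanoBaker

section LinearODE

variable {F : Type*} [NormedAddCommGroup F] [NormedSpace ℝ F]

theorem eq_of_hasDerivAt_clm {L : ℝ → F →L[ℝ] F} (hL : Continuous L) {f g : ℝ → F}
    (hf : ∀ s, HasDerivAt f (L s (f s)) s) (hg : ∀ s, HasDerivAt g (L s (g s)) s)
    (h0 : f 0 = g 0) : f = g := by
  funext s
  obtain ⟨C, hC⟩ := exists_norm_le_of_continuous hL (|s| + 1)
  have hmem : ∀ r, |r| < |s| + 1 → r ∈ Set.Ioo (-(|s| + 1)) (|s| + 1) := fun r hr => abs_lt.1 hr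
  refine ODE_solution_unique_of_mem_Ioo (v := fun r x => L r x) (s := fun _ => Set.univ)
    (K := C.toNNReal) (fun r hr => ?_) (hmem 0 (by simpa using by positivity))
    (fun r _ => ⟨hf r, trivial⟩) (fun r _ => ⟨hg r, trivial⟩) h0 (hmem s (lt_add_one _))
  refine ((L r).lipschitz.weaken ?_).lipschitzOnWith
  exact NNReal.le_toNNReal_of_coe_le (hC r (abs_lt.2 hr).le)

variable {R : Type*} [NormedRing R] [NormedAlgebra ℝ R] [CompleteSpace R] {E : ℝ → R}

theorem eq_peanoBaker_mul (hE : Continuous E) {B : ℝ → R}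
    (hB : ∀ s, HasDerivAt B (E s * B s) s) (s : ℝ) : B s = peanoBaker E s * B 0 := by
  refine congrFun (eq_of_hasDerivAt_clm (g := fun r => peanoBaker E r * B 0)
    ((ContinuousLinearMap.mul ℝ R).continuous.comp hE) hB (fun r => ?_) ?_) s
  · simpa [mul_assoc] using (hasDerivAt_peanoBaker hE r).mul_const (B 0)
  · rw [peanoBaker_zero_right, one_mul]

theorem peanoBaker_add_period (hE : Continuous E) {T : ℝ} (hT : Function.Periodic E T) (s : ℝ) :
    peanoBaker E (s + T) = peanoBaker E s * peanoBaker E T := by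
  simpa using eq_peanoBaker_mul hE (B := fun r => peanoBaker E (r + T))
    (fun r => by simpa [hT r] using (hasDerivAt_peanoBaker hE (r + T)).comp_add_const r T) s

theorem peanoBaker_nat_mul_period (hE : Continuous E) {T : ℝ} (hT : Function.Periodic E T)
    (ℓ : ℕ) : peanoBaker E (ℓ * T) = peanoBaker E T ^ ℓ := by
  induction ℓ with
  | zero => simp [peanoBaker_zero_right]
  | succ n ih =>
    rw [Nat.cast_succ, add_one_mul, peanoBaker_add_period hE hT, ih, pow_succ]

end LinearODE

section PowerSeries

open scoped NNReal

variable {𝕜 F : Type*} [NontriviallyNormedField 𝕜] [NormedAddCommGroup F]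
  [NormedSpace 𝕜 F] [CompleteSpace F]

theorem analyticOnNhd_tsum_pow_smul {c : ℕ → F}
    (hc : ∀ r : ℝ≥0, Summable fun n => ‖c n‖ * (r : ℝ) ^ n) :
    AnalyticOnNhd 𝕜 (fun z : 𝕜 => ∑' n, z ^ n • c n) Set.univ := by
  let p : FormalMultilinearSeries 𝕜 𝕜 F := fun n =>
    ContinuousMultilinearMap.mkPiRing 𝕜 (Fin n) (c n)
  have hradius : p.radius = ⊤ :=
    p.radius_eq_top_of_summable_norm fun r => by
      simpa only [p, ContinuousMultilinearMap.norm_mkPiRing] using hc r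
  have hsum : p.sum = fun z : 𝕜 => ∑' n, z ^ n • c n := by
    funext z
    simp [FormalMultilinearSeries.sum, p]
  have h := (p.hasFPowerSeriesOnBall (by simp [hradius])).analyticOnNhd
  rwa [hradius, Metric.eball_top, hsum] at h

theorem analyticOnNhd_peanoBaker_smul {R : Type*} [NormedRing R] [NormedAlgebra ℝ R]
    [CompleteSpace R] {E : ℝ → R} (hE : Continuous E) (s : ℝ) :
    AnalyticOnNhd ℝ (fun μ : ℝ => peanoBaker (μ • E) s) Set.univ := by
  simp only [peanoBaker_smul]
  refine analyticOnNhd_tsum_pow_smul fun r => ?_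
  refine (summable_norm_peanoBakerTerm (hE.const_smul (r : ℝ)) s).congr fun n => ?_
  rw [peanoBakerTerm_smul, norm_smul, norm_pow, Real.norm_of_nonneg r.coe_nonneg,
    mul_comm]

end PowerSeries

theorem exists_rat_cos_mem_Ioo {a b : ℝ} (hab : a < b) (ha : -1 ≤ a) (hb : b ≤ 1) :
    ∃ r : ℚ, Real.cos (2 * Real.pi * r) ∈ Set.Ioo a b := by
  refine Rat.denseRange_cast.exists_mem_open
    (isOpen_Ioo.preimage (by fun_prop : Continuous fun t : ℝ => Real.cos (2 * Real.pi * t)))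
    ⟨Real.arccos ((a + b) / 2) / (2 * Real.pi), ?_⟩
  rw [Set.mem_preimage, mul_div_cancel₀ _ Real.two_pi_pos.ne',
    Real.cos_arccos (by linarith) (by linarith)]
  constructor <;> linarith

theorem exists_eq_cos_rat_of_analyticOnNhd {f : ℝ → ℝ} (hf : AnalyticOnNhd ℝ f Set.univ) {x₀ : ℝ}
    (hx₀ : f x₀ = 1) {J : Set ℝ} (hJopen : IsOpen J) (hJ : IsConnected J)
    (hbound : ∀ x ∈ J, |f x| ≤ 1) : ∃ x ∈ J, ∃ r : ℚ, f x = Real.cos (2 * Real.pi * r) := by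
  obtain ⟨x, hx⟩ := hJ.nonempty
  by_cases hconst : ∀ y ∈ J, f y = f x
  · have hglobal : f = fun _ => f x := hf.eq_of_eventuallyEq analyticOnNhd_const
      (Filter.eventually_of_mem (hJopen.mem_nhds hx) hconst)
    exact ⟨x, hx, 0, by simp [← congrFun hglobal x₀, hx₀]⟩
  · push Not at hconst
    obtain ⟨y, hy, hne⟩ := hconst
    obtain ⟨r, hr⟩ := exists_rat_cos_mem_Ioo (min_lt_max.2 hne)
      (le_min (abs_le.1 (hbound y hy)).1 (abs_le.1 (hbound x hx)).1)
      (max_le (abs_le.1 (hbound y hy)).2 (abs_le.1 (hbound x hx)).2)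
    have himage : Set.uIcc (f y) (f x) ⊆ f '' J :=
      (hJ.isPreconnected.image f
        (hf.continuousOn.mono (Set.subset_univ J))).ordConnected.uIcc_subset
        (Set.mem_image_of_mem f hy) (Set.mem_image_of_mem f hx)
    obtain ⟨z, hz, hfz⟩ := himage (Set.Ioo_subset_Icc_self hr)
    exact ⟨z, hz, r, hfz⟩

theorem pow_eq_one_of_spectrum {A : Type*} [CStarAlgebra A] {a : A} [IsStarNormal a] {n : ℕ}
    (h : ∀ z ∈ spectrum ℂ a, z ^ n = 1) : a ^ n = 1 := by
  rw [← cfc_pow_id (R := ℂ) a n, cfc_congr (g := fun _ => 1) h, cfc_const_one ℂ a]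

section Charpoly

open Matrix Polynomial

variable {n R : Type*} [Fintype n] [DecidableEq n] [CommRing R]

theorem reverse_charpoly_of_mem_specialOrthogonalGroup {N : Matrix n n R}
    (hN : N ∈ specialOrthogonalGroup n R) (hn : Even (Fintype.card n)) :
    N.charpoly.reverse = N.charpoly := by
  obtain ⟨horth, hdet⟩ := mem_specialOrthogonalGroup_iff.1 hN
  have hinv : N⁻¹ = Nᵀ := inv_eq_left_inv ((mem_orthogonalGroup_iff' n R).1 horth)
  have h := charpoly_inv N ((isUnit_iff_isUnit_det N).2 (hdet ▸ isUnit_one))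
  rw [hinv, charpoly_transpose, hdet, hn.neg_one_pow] at h
  rw [reverse_charpoly]
  simpa using h.symm

theorem eq_sub_one_sq_mul_of_reverse_eq {f : R[X]} (hf : f.Monic) (hdeg : f.natDegree = 4)
    (hrev : f.reverse = f) (hroot : f.eval 1 = 0) :
    f = (X - 1) ^ 2 * (X ^ 2 + C (f.coeff 3 + 2) * X + 1) := by
  have h4 : f.coeff 4 = 1 := hdeg ▸ hf.coeff_natDegree
  have h0 : f.coeff 0 = 1 := by rw [← hrev, coeff_zero_reverse, hf.leadingCoeff]
  have h1 : f.coeff 1 = f.coeff 3 := by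
    conv_lhs => rw [← hrev, coeff_reverse, hdeg]
    rfl
  have hsum : f = 1 + C (f.coeff 3) * X + C (f.coeff 2) * X ^ 2 + C (f.coeff 3) * X ^ 3
      + X ^ 4 := by
    conv_lhs => rw [f.as_sum_range_C_mul_X_pow, hdeg]
    simp [Finset.sum_range_succ, h0, h1, h4]
  have h2 : f.coeff 2 = -2 * f.coeff 3 - 2 := by
    rw [hsum] at hroot
    simp only [eval_add, eval_mul, eval_C, eval_X, eval_pow, eval_one] at hroot
    linear_combination hroot
  conv_lhs => rw [hsum, h2]
  simp only [map_sub, map_add, map_neg, map_mul, C_ofNat]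
  ring

theorem eval_one_charpoly_of_mulVec_eq [IsDomain R] {N : Matrix n n R} {v : n → R} (hv : v ≠ 0)
    (hNv : N *ᵥ v = v) : N.charpoly.eval 1 = 0 := by
  rw [eval_charpoly]
  exact exists_mulVec_eq_zero_iff.1 ⟨v, hv, by simp [sub_mulVec, hNv]⟩

theorem charpoly_eq_of_mem_specialOrthogonalGroup [IsDomain R] {N : Matrix (Fin 4) (Fin 4) R}
    (hN : N ∈ specialOrthogonalGroup (Fin 4) R) {v : Fin 4 → R} (hv : v ≠ 0) (hNv : N *ᵥ v = v) :
    N.charpoly = (X - 1) ^ 2 * (X ^ 2 - C (N.trace - 2) * X + 1) := by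
  have h := eq_sub_one_sq_mul_of_reverse_eq N.charpoly_monic (by simp)
    (reverse_charpoly_of_mem_specialOrthogonalGroup hN (by decide))
    (eval_one_charpoly_of_mulVec_eq hv hNv)
  have htrace : N.charpoly.coeff 3 + 2 = -(N.trace - 2) := by
    simp [trace_eq_neg_charpoly_coeff, add_comm]
  rwa [htrace, C_neg, neg_mul, ← sub_eq_add_neg] at h

end Charpoly

section Spectrum

open Matrix
open scoped Matrix.Norms.L2Operator

variable {N : Matrix (Fin 4) (Fin 4) ℝ} {v : Fin 4 → ℝ}

theorem mapMatrix_ofRealHom_mem_unitary {n : Type*} [Fintype n] [DecidableEq n] {N : Matrix n n ℝ}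
    (hN : N ∈ orthogonalGroup n ℝ) : Complex.ofRealHom.mapMatrix N ∈ unitary (Matrix n n ℂ) := by
  have hstar : star (Complex.ofRealHom.mapMatrix N) = Complex.ofRealHom.mapMatrix Nᵀ := by
    ext i j
    simp [star_apply]
  rw [← unitaryGroup, mem_unitaryGroup_iff', hstar, ← map_mul,
    (mem_orthogonalGroup_iff' n ℝ).1 hN, map_one]

theorem mem_spectrum_mapMatrix_iff (hN : N ∈ specialOrthogonalGroup (Fin 4) ℝ) (hv : v ≠ 0)
    (hNv : N *ᵥ v = v) (z : ℂ) :
    z ∈ spectrum ℂ (Complex.ofRealHom.mapMatrix N) ↔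
      z = 1 ∨ z ^ 2 - (N.trace - 2) * z + 1 = 0 := by
  rw [mem_spectrum_iff_isRoot_charpoly, RingHom.mapMatrix_apply, charpoly_map,
    charpoly_eq_of_mem_specialOrthogonalGroup hN hv hNv]
  simp [Polynomial.IsRoot, sub_eq_zero]

theorem abs_trace_sub_two_le_of_mem_specialOrthogonalGroup
    (hN : N ∈ specialOrthogonalGroup (Fin 4) ℝ) (hv : v ≠ 0) (hNv : N *ᵥ v = v) :
    |N.trace - 2| ≤ 2 := by
  obtain ⟨z, hz⟩ : ∃ z : ℂ, z ^ 2 - (N.trace - 2) * z + 1 = 0 := by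
    obtain ⟨d, hd⟩ := IsAlgClosed.exists_eq_mul_self (discrim 1 (-(N.trace - 2 : ℂ)) 1)
    obtain ⟨z, hz⟩ := exists_quadratic_eq_zero one_ne_zero ⟨d, hd⟩
    exact ⟨z, by linear_combination hz⟩
  have hnorm : ‖z‖ = 1 := spectrum.norm_eq_one_of_unitary
    (mapMatrix_ofRealHom_mem_unitary (mem_specialOrthogonalGroup_iff.1 hN).1)
    ((mem_spectrum_mapMatrix_iff hN hv hNv z).2 (.inr hz))
  have hconj : z * starRingEnd ℂ z = 1 := by simp [Complex.mul_conj', hnorm]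
  have htrace : N.trace - 2 = 2 * z.re := by
    have : (N.trace - 2 : ℂ) = z + starRingEnd ℂ z := by
      linear_combination (-starRingEnd ℂ z) * hz + (z - N.trace + 2) * hconj
    exact_mod_cast this.trans (Complex.add_conj z)
  rw [htrace, abs_mul, abs_two]
  linarith [hnorm ▸ Complex.abs_re_le_norm z]

theorem pow_den_eq_one_of_trace_eq (hN : N ∈ specialOrthogonalGroup (Fin 4) ℝ) (hv : v ≠ 0)
    (hNv : N *ᵥ v = v) {r : ℚ} (hr : N.trace = 2 + 2 * Real.cos (2 * Real.pi * r)) :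
    N ^ r.den = 1 := by
  have hunitary := mapMatrix_ofRealHom_mem_unitary (mem_specialOrthogonalGroup_iff.1 hN).1
  have := isStarNormal_of_mem_unitary hunitary
  set ζ := Complex.exp (2 * Real.pi * Complex.I * r) with hζ
  have hζpow : ζ ^ r.den = 1 := (Complex.isPrimitiveRoot_exp_rat r).pow_eq_one
  have hζ0 : ζ ≠ 0 := Complex.exp_ne_zero _
  have htrace : (N.trace - 2 : ℂ) = ζ + ζ⁻¹ := by
    rw [hr]
    push_cast
    rw [add_sub_cancel_left, Complex.two_cos, hζ, ← Complex.exp_neg]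
    ring_nf
  have hpow : Complex.ofRealHom.mapMatrix N ^ r.den = 1 := pow_eq_one_of_spectrum fun z hz => by
    rcases (mem_spectrum_mapMatrix_iff hN hv hNv z).1 hz with rfl | hz
    · exact one_pow _
    have hfactor : (z - ζ) * (z - ζ⁻¹) = 0 := by
      rw [htrace] at hz
      linear_combination hz + mul_inv_cancel₀ hζ0
    rcases mul_eq_zero.1 hfactor with h | h
    · rw [sub_eq_zero.1 h, hζpow]
    · rw [sub_eq_zero.1 h, inv_pow, hζpow, inv_one]
  refine map_injective Complex.ofReal_injective ?_
  calc (N ^ r.den).map Complex.ofReal = Complex.ofRealHom.mapMatrix N ^ r.den :=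
        map_pow Complex.ofRealHom.mapMatrix N r.den
    _ = Complex.ofRealHom.mapMatrix 1 := by rw [hpow, map_one]

end Spectrum

section Conjugation

open Matrix
open scoped MatrixOrder Matrix.Norms.L2Operator

theorem exists_units_conj_mem_orthogonalGroup {n : Type*} [Fintype n] [DecidableEq n]
    {P M : Matrix n n ℝ} (hP : P.PosDef) (hM : Mᵀ * P * M = P) :
    ∃ B : (Matrix n n ℝ)ˣ, B.val * M * B⁻¹.val ∈ orthogonalGroup n ℝ := by
  obtain ⟨B, hB, hPB⟩ := CStarAlgebra.isStrictlyPositive_iff_eq_star_mul_self.mp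
    hP.isStrictlyPositive
  lift B to (Matrix n n ℝ)ˣ using hB
  replace hPB : P = B.valᵀ * B.val := by rw [hPB]; rfl
  have hinv : B⁻¹.valᵀ * B.valᵀ = 1 := by rw [← transpose_mul, B.mul_inv, transpose_one]
  refine ⟨B, (mem_orthogonalGroup_iff' n ℝ).2 ?_⟩
  calc (B.val * M * B⁻¹.val)ᵀ * (B.val * M * B⁻¹.val)
      = B⁻¹.valᵀ * (Mᵀ * (B.valᵀ * B.val) * M) * B⁻¹.val := by
        simp only [transpose_mul, Matrix.mul_assoc]
    _ = B⁻¹.valᵀ * B.valᵀ * (B.val * B⁻¹.val) := by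
        rw [← hPB, hM, hPB]
        simp only [Matrix.mul_assoc]
    _ = 1 := by rw [hinv, B.mul_inv, one_mul]

end Conjugation

namespace LightconeModel

open Matrix

theorem ip_comm (x y : V) : ip x y = ip y x := by
  simp only [ip_eq]
  ring

theorem ip_add_right (x y z : V) : ip x (y + z) = ip x y + ip x z := dotProduct_add _ _ _

theorem ip_smul_right (a : ℝ) (x y : V) : ip x (a • y) = a * ip x y := dotProduct_smul _ _ _

theorem ip_add_left (x y z : V) : ip (x + y) z = ip x z + ip y z := by
  rw [ip_comm, ip_add_right, ip_comm z, ip_comm z]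

theorem ip_smul_left (a : ℝ) (x y : V) : ip (a • x) y = a * ip x y := by
  rw [ip_comm, ip_smul_right, ip_comm]

section Timelike

variable {v : V}

theorem ip_self_pos_of_ip_timelike_eq_zero (hv : ip v v < 0) {w : V} (hw : w ≠ 0)
    (hwv : ip w v = 0) : 0 < ip w w := by
  rw [ip_eq] at hv hwv
  have hspace : 0 < w 1 ^ 2 + w 2 ^ 2 + w 3 ^ 2 := by
    by_contra! h
    have h1 : w 1 = 0 := by nlinarith only [h, sq_nonneg (w 1), sq_nonneg (w 2), sq_nonneg (w 3)]
    have h2 : w 2 = 0 := by nlinarith only [h, sq_nonneg (w 1), sq_nonneg (w 2), sq_nonneg (w 3)]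
    have h3 : w 3 = 0 := by nlinarith only [h, sq_nonneg (w 1), sq_nonneg (w 2), sq_nonneg (w 3)]
    have hv0 : v 0 ≠ 0 := fun h0 => by
      rw [h0] at hv
      nlinarith only [hv, sq_nonneg (v 1), sq_nonneg (v 2), sq_nonneg (v 3)]
    have h0 : w 0 = 0 := by simpa [h1, h2, h3, hv0] using hwv
    exact hw (by ext i; fin_cases i <;> assumption)
  -- Lagrange's identity for the spatial parts
  have hlagrange : v 0 ^ 2 * ip w w = -ip v v * (w 1 ^ 2 + w 2 ^ 2 + w 3 ^ 2)
      + ((w 1 * v 2 - w 2 * v 1) ^ 2 + (w 1 * v 3 - w 3 * v 1) ^ 2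
        + (w 2 * v 3 - w 3 * v 2) ^ 2) := by
    simp only [ip_eq]
    linear_combination (w 0 * v 0 + (w 1 * v 1 + w 2 * v 2 + w 3 * v 3)) * hwv
  refine pos_of_mul_pos_right (a := v 0 ^ 2) ?_ (sq_nonneg _)
  rw [hlagrange, ip_eq]
  have := neg_pos.2 hv
  positivity

/-- Up to scale, the form obtained from `ip` by reversing its sign along `v`. For timelike `v` it
is positive definite, and the isometries of `ip` that fix `v` preserve it. -/
def flippedForm (v : V) : Matrix (Fin 4) (Fin 4) ℝ :=
  -ip v v • gram + (2 : ℝ) • vecMulVec (gram *ᵥ v) (gram *ᵥ v)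

theorem dotProduct_flippedForm_mulVec (u : V) :
    u ⬝ᵥ flippedForm v *ᵥ u = -ip v v * ip u u + 2 * ip u v ^ 2 := by
  rw [flippedForm, add_mulVec, smul_mulVec, smul_mulVec, vecMulVec_mulVec, dotProduct_add,
    dotProduct_smul, dotProduct_smul, op_smul_eq_smul, dotProduct_smul, dotProduct_comm u,
    dotProduct_comm u, ← ip, ← ip, ip_comm v u]
  simp only [smul_eq_mul, sq]

theorem posDef_flippedForm (hv : ip v v < 0) : (flippedForm v).PosDef := by
  refine PosDef.of_dotProduct_mulVec_pos ?_ fun u hu => ?_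
  · simp [flippedForm, gram, IsHermitian, transpose_vecMulVec]
  rw [star_trivial, dotProduct_flippedForm_mulVec]
  set w := ip v v • u + (-ip u v) • v with hw
  have hwv : ip w v = 0 := by
    rw [hw, ip_add_left, ip_smul_left, ip_smul_left]
    ring
  have hww : ip w w = -ip v v * (-ip v v * ip u u + ip u v ^ 2) := by
    rw [hw]
    simp only [ip_add_left, ip_smul_left, ip_add_right, ip_smul_right, ip_comm v u]
    ring
  have hc : 0 < -ip v v := neg_pos.2 hv
  rcases eq_or_ne w 0 with h0 | h0
  · have huv : ip u v ≠ 0 := fun huv => by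
      simp [hw, huv, hv.ne, hu] at h0
    have hsum : -ip v v * ip u u + ip u v ^ 2 = 0 := by
      simpa [h0, ip_eq 0, hv.ne] using hww
    linarith [pow_pos (abs_pos.2 huv) 2, sq_abs (ip u v)]
  · have hpos := ip_self_pos_of_ip_timelike_eq_zero hv h0 hwv
    rw [hww] at hpos
    linarith [pos_of_mul_pos_right hpos hc.le, sq_nonneg (ip u v)]

variable {M : Matrix (Fin 4) (Fin 4) ℝ}

theorem transpose_mul_flippedForm_mul (hM : Mᵀ * gram * M = gram) (hMv : M *ᵥ v = v) :
    Mᵀ * flippedForm v * M = flippedForm v := by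
  have h : Mᵀ *ᵥ gram *ᵥ v = gram *ᵥ v := by
    calc Mᵀ *ᵥ gram *ᵥ v = Mᵀ *ᵥ gram *ᵥ M *ᵥ v := by rw [hMv]
      _ = (Mᵀ * gram * M) *ᵥ v := by simp only [mulVec_mulVec, Matrix.mul_assoc]
      _ = gram *ᵥ v := by rw [hM]
  simp only [flippedForm, Matrix.mul_add, Matrix.add_mul, Matrix.mul_smul, Matrix.smul_mul, hM,
    mul_vecMulVec, vecMulVec_mul, ← mulVec_transpose, h]

theorem exists_units_conj_mem_specialOrthogonalGroup (hv : ip v v < 0)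
    (hM : Mᵀ * gram * M = gram) (hdet : M.det = 1) (hMv : M *ᵥ v = v) :
    ∃ B : (Matrix (Fin 4) (Fin 4) ℝ)ˣ, ∃ w ≠ 0,
      B.val * M * B⁻¹.val ∈ specialOrthogonalGroup (Fin 4) ℝ ∧ (B.val * M * B⁻¹.val) *ᵥ w = w := by
  obtain ⟨B, hB⟩ := exists_units_conj_mem_orthogonalGroup (posDef_flippedForm hv)
    (transpose_mul_flippedForm_mul hM hMv)
  have hcancel : B⁻¹.val *ᵥ B.val *ᵥ v = v := by simp [mulVec_mulVec]
  refine ⟨B, B.val *ᵥ v, fun h => ?_, mem_specialOrthogonalGroup_iff.2 ⟨hB, ?_⟩, ?_⟩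
  · rw [h, mulVec_zero] at hcancel
    simp [← hcancel, ip_eq] at hv
  · rw [det_units_conj, hdet]
  · rw [← mulVec_mulVec, ← mulVec_mulVec, hcancel, hMv]

theorem abs_trace_sub_two_le_of_timelike_fixed (hv : ip v v < 0) (hM : Mᵀ * gram * M = gram)
    (hdet : M.det = 1) (hMv : M *ᵥ v = v) : |M.trace - 2| ≤ 2 := by
  obtain ⟨B, w, hw, hB, hBw⟩ := exists_units_conj_mem_specialOrthogonalGroup hv hM hdet hMv
  rw [← trace_units_conj B M]
  exact abs_trace_sub_two_le_of_mem_specialOrthogonalGroup hB hw hBw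

theorem pow_den_eq_one_of_timelike_fixed (hv : ip v v < 0) (hM : Mᵀ * gram * M = gram)
    (hdet : M.det = 1) (hMv : M *ᵥ v = v) {r : ℚ}
    (hr : M.trace = 2 + 2 * Real.cos (2 * Real.pi * r)) : M ^ r.den = 1 := by
  obtain ⟨B, w, hw, hB, hBw⟩ := exists_units_conj_mem_specialOrthogonalGroup hv hM hdet hMv
  have h := pow_den_eq_one_of_trace_eq hB hw hBw (r := r) (by rw [trace_units_conj, hr])
  rw [Units.conj_pow, Units.mul_inv_eq_iff_eq_mul, one_mul] at h
  exact (Units.mul_right_inj B).1 (h.trans (mul_one _).symm)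

end Timelike

end LightconeModel

section Isometry

open Matrix
open scoped Matrix.Norms.Operator

variable {n : Type*} [Fintype n] [DecidableEq n] {E : ℝ → Matrix n n ℝ}

theorem peanoBaker_mulVec (hE : Continuous E) {v : ℝ → n → ℝ}
    (hv : ∀ s, HasDerivAt v (E s *ᵥ v s) s) (s : ℝ) : peanoBaker E s *ᵥ v 0 = v s := by
  let L := (mulVecBilin ℝ ℝ : Matrix n n ℝ →ₗ[ℝ] (n → ℝ) →ₗ[ℝ] n → ℝ).toContinuousBilinearMap
  refine congrFun (eq_of_hasDerivAt_clm (f := fun r => peanoBaker E r *ᵥ v 0)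
    (L.continuous.comp hE) (fun r => ?_) hv ?_) s
  · exact ((L.flip (v 0)).hasFDerivAt.comp_hasDerivAt r (hasDerivAt_peanoBaker hE r)).congr_deriv
      (mulVec_mulVec _ _ _).symm
  · rw [peanoBaker_zero_right, one_mulVec]

variable {G : Matrix n n ℝ}

theorem transpose_peanoBaker_mul_mul (hE : Continuous E)
    (hskew : ∀ s, (E s)ᵀ * G + G * E s = 0) (s : ℝ) :
    (peanoBaker E s)ᵀ * G * peanoBaker E s = G := by
  have hA := hasDerivAt_peanoBaker hE
  have hAt (r : ℝ) : HasDerivAt (fun t => (peanoBaker E t)ᵀ) (E r * peanoBaker E r)ᵀ r :=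
    (transposeLinearEquiv n n ℝ ℝ).toLinearMap.toContinuousLinearMap.hasFDerivAt.comp_hasDerivAt
      r (hA r)
  have hconst (r : ℝ) :
      HasDerivAt (fun t => (peanoBaker E t)ᵀ * G * peanoBaker E t) 0 r := by
    refine (((hAt r).mul_const G).mul (hA r)).congr_deriv ?_
    calc (E r * peanoBaker E r)ᵀ * G * peanoBaker E r
          + (peanoBaker E r)ᵀ * G * (E r * peanoBaker E r)
        = (peanoBaker E r)ᵀ * ((E r)ᵀ * G + G * E r) * peanoBaker E r := by
          simp only [transpose_mul, Matrix.mul_assoc, Matrix.mul_add, Matrix.add_mul]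
      _ = 0 := by rw [hskew, Matrix.mul_zero, Matrix.zero_mul]
  simpa [peanoBaker_zero_right] using is_const_of_deriv_eq_zero
    (fun r => (hconst r).differentiableAt) (fun r => (hconst r).deriv) s 0

theorem det_peanoBaker_eq_one (hE : Continuous E) (hG : G.det ≠ 0)
    (hskew : ∀ s, (E s)ᵀ * G + G * E s = 0) (s : ℝ) : (peanoBaker E s).det = 1 := by
  have hsq (r : ℝ) : (peanoBaker E r).det ^ 2 = 1 := by
    have h := congrArg det (transpose_peanoBaker_mul_mul hE hskew r)
    rw [det_mul, det_mul, det_transpose] at h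
    exact mul_right_cancel₀ hG (by linear_combination h)
  have hcont : Continuous fun r => (peanoBaker E r).det :=
    (continuous_iff_continuousAt.2 fun r => (hasDerivAt_peanoBaker hE r).continuousAt).matrix_det
  exact isPreconnected_univ.eq_of_sq_eq (g := 1) (y := 0) hcont.continuousOn continuousOn_const
    (fun r _ => by simpa using hsq r) (fun _ => one_ne_zero) trivial
    (by simp [peanoBaker_zero_right]) trivial

end Isometry

namespace LightconeModel

open Matrix

theorem det_gram_ne_zero : gram.det ≠ 0 := by simp [gram, Fin.prod_univ_four]

theorem wedge_skew (x y : V) : (wedge x y)ᵀ * gram + gram * wedge x y = 0 := by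
  have hsymm : gramᵀ = gram := diagonal_transpose _
  simp only [wedge, transpose_sub, transpose_vecMulVec, Matrix.sub_mul, Matrix.mul_sub,
    vecMulVec_mul, mul_vecMulVec, ← mulVec_transpose, hsymm]
  abel

theorem hasDerivAt_ip {f g : ℝ → V} {f' g' : V} {s : ℝ} (hf : HasDerivAt f f' s)
    (hg : HasDerivAt g g' s) :
    HasDerivAt (fun r => ip (f r) (g r)) (ip (f s) g' + ip f' (g s)) s := by
  let B : V →ₗ[ℝ] V →ₗ[ℝ] ℝ :=
    LinearMap.mk₂ ℝ ip ip_add_left ip_smul_left ip_add_right ip_smul_right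
  exact B.toContinuousBilinearMap.hasDerivAt_of_bilinear (fun _ => hf) fun _ => hg

theorem eq_of_mem_spaceForm {p Y Z : V} (hY : Y ∈ spaceForm p) (hZ : Z ∈ spaceForm p)
    {l : Projectivization ℝ V} (hYl : Y ∈ l.submodule) (hZl : Z ∈ l.submodule) : Y = Z := by
  rw [Projectivization.submodule_eq, Submodule.mem_span_singleton] at hYl hZl
  obtain ⟨a, rfl⟩ := hYl
  obtain ⟨b, rfl⟩ := hZl
  have ha : a * ip l.rep p = -1 := by rw [← ip_smul_left, hY.2]
  have hb : b * ip l.rep p = -1 := by rw [← ip_smul_left, hZ.2]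
  have hne : ip l.rep p ≠ 0 := fun h => by simp [h] at ha
  rw [mul_right_cancel₀ hne (ha.trans hb.symm)]

section IsLift

variable {L : ℝ → ConformalSphere} {X : ℝ → V}

theorem IsLift.hasDerivAt (hX : IsLift L X) (s : ℝ) : HasDerivAt X (deriv X s) s :=
  (hX.smooth.differentiable (by simp) s).hasDerivAt

theorem IsLift.continuous_deriv (hX : IsLift L X) : Continuous (deriv X) :=
  hX.smooth.continuous_deriv (by simp)

theorem IsLift.comp_add_const (hX : IsLift L X) {T : ℝ} (hL : Function.Periodic L T) :
    IsLift L fun s => X (s + T) where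
  smooth := hX.smooth.comp (contDiff_id.add contDiff_const)
  ne_zero s := hX.ne_zero (s + T)
  mem s := hL s ▸ hX.mem (s + T)

theorem IsLift.ip_self (hX : IsLift L X) (s : ℝ) : ip (X s) (X s) = 0 :=
  (L s).2 _ (hX.mem s)

theorem IsLift.ip_deriv_self (hX : IsLift L X) (s : ℝ) : ip (deriv X s) (X s) = 0 := by
  have h := hasDerivAt_ip (hX.hasDerivAt s) (hX.hasDerivAt s)
  simp only [hX.ip_self] at h
  have := h.unique (hasDerivAt_const s 0)
  rw [ip_comm (X s)] at this
  linarith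

theorem IsLift.ip_deriv_eq_zero (hX : IsLift L X) {p : V} (hmem : ∀ s, X s ∈ spaceForm p)
    (s : ℝ) : ip (deriv X s) p = 0 := by
  have h := hasDerivAt_ip (hX.hasDerivAt s) (hasDerivAt_const s p)
  simp only [fun r => (hmem r).2] at h
  simpa [ip_eq _ 0] using h.unique (hasDerivAt_const s (-1))

theorem IsLift.periodic_of_mem_spaceForm (hX : IsLift L X) {p : V}
    (hmem : ∀ s, X s ∈ spaceForm p) {T : ℝ} (hL : Function.Periodic L T) :
    Function.Periodic X T := fun s =>
  eq_of_mem_spaceForm (hmem (s + T)) (hmem s) ((hX.comp_add_const hL).mem s) (hX.mem s)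

end IsLift

namespace PolarisedCurve

open scoped Matrix.Norms.Operator

variable {Λ : PolarisedCurve} {X : ℝ → V} {T : ℝ}

theorem continuous_eta (hX : IsLift Λ.L X) : Continuous (Λ.eta X) := by
  obtain ⟨Y, hY, hregular⟩ := Λ.regular
  rw [funext (Λ.eta_eq X Y hX hY)]
  have hspeed : Continuous fun s => ip (deriv Y s) (deriv Y s) := by
    have := hY.continuous_deriv
    unfold ip
    fun_prop
  have hwedge : Continuous fun s => wedge (Y s) (deriv Y s) := by
    have := hY.smooth.continuous
    have := hY.continuous_deriv
    unfold wedge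
    fun_prop
  exact (Λ.q_smooth.continuous.div hspeed fun s => (hregular s).ne').smul hwedge

theorem eta_skew (Λ : PolarisedCurve) (X : ℝ → V) (s : ℝ) :
    (Λ.eta X s)ᵀ * gram + gram * Λ.eta X s = 0 := by
  rw [eta, transpose_smul, Matrix.smul_mul, Matrix.mul_smul, ← smul_add, wedge_skew, smul_zero]

theorem periodic_eta (hclosed : Λ.IsClosedWithPeriod T) (hX : IsLift Λ.L X) :
    Function.Periodic (Λ.eta X) T := fun s => by
  rw [← Λ.eta_eq (fun r => X (r + T)) X (hX.comp_add_const hclosed.1) hX s]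
  simp only [eta, deriv_comp_add_const, hclosed.2 s]

theorem eta_eq_wedge (harc : ∀ s, Λ.q s = ip (deriv X s) (deriv X s)) (s : ℝ) :
    Λ.eta X s = wedge (X s) (deriv X s) := by
  rw [eta, ← harc, div_self (Λ.q_ne_zero s), one_smul]

/-- The monodromy matrix over the period `T` with spectral parameter `μ`, computed from the lift
`X`; it depends on the lift only through `eta`. -/
noncomputable def monodromy (Λ : PolarisedCurve) (X : ℝ → V) (T μ : ℝ) : Matrix (Fin 4) (Fin 4) ℝ :=
  peanoBaker (-μ • Λ.eta X) T

theorem isMonodromy_monodromy (hX : IsLift Λ.L X) (T μ : ℝ) :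
    Λ.IsMonodromy T μ (Λ.monodromy X T μ) := by
  refine ⟨X, hX, peanoBaker (-μ • Λ.eta X), peanoBaker_zero_right _, fun s i j => ?_, rfl⟩
  have h := hasDerivAt_peanoBaker ((continuous_eta hX).const_smul (-μ)) s
  rw [Pi.smul_apply, smul_mul_assoc] at h
  exact hasDerivAt_pi.1 (hasDerivAt_pi.1 h i) j

theorem skew_smul_eta (μ s : ℝ) :
    ((μ • Λ.eta X) s)ᵀ * gram + gram * (μ • Λ.eta X) s = 0 := by
  rw [Pi.smul_apply, transpose_smul, Matrix.smul_mul, Matrix.mul_smul, ← smul_add, eta_skew,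
    smul_zero]

theorem transpose_monodromy_mul_gram_mul (hX : IsLift Λ.L X) (T μ : ℝ) :
    (Λ.monodromy X T μ)ᵀ * gram * Λ.monodromy X T μ = gram :=
  transpose_peanoBaker_mul_mul ((continuous_eta hX).const_smul (-μ)) (skew_smul_eta (-μ)) T

theorem det_monodromy (hX : IsLift Λ.L X) (T μ : ℝ) : (Λ.monodromy X T μ).det = 1 :=
  det_peanoBaker_eq_one ((continuous_eta hX).const_smul (-μ)) det_gram_ne_zero
    (skew_smul_eta (-μ)) T

theorem monodromy_zero (Λ : PolarisedCurve) (X : ℝ → V) (T : ℝ) : Λ.monodromy X T 0 = 1 := by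
  rw [monodromy, neg_zero, zero_smul, peanoBaker_zero_left]

theorem monodromy_nat_mul (hclosed : Λ.IsClosedWithPeriod T) (hX : IsLift Λ.L X) (μ : ℝ)
    (ℓ : ℕ) : Λ.monodromy X (ℓ * T) μ = Λ.monodromy X T μ ^ ℓ :=
  peanoBaker_nat_mul_period ((continuous_eta hX).const_smul (-μ))
    ((periodic_eta hclosed hX).smul (-μ)) ℓ

theorem analyticOnNhd_trace_monodromy (hX : IsLift Λ.L X) (T : ℝ) :
    AnalyticOnNhd ℝ (fun μ => (Λ.monodromy X T μ).trace) Set.univ :=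
  (traceLinearMap (Fin 4) ℝ ℝ).toContinuousLinearMap.comp_analyticOnNhd
    ((analyticOnNhd_peanoBaker_smul (continuous_eta hX) T).comp analyticOnNhd_id.neg
      (Set.mapsTo_univ _ _))

theorem isResonancePoint_of_monodromy_pow_eq_one (hclosed : Λ.IsClosedWithPeriod T)
    (hX : IsLift Λ.L X) {μ : ℝ} (hμ : μ ≠ 0) {ℓ : ℕ} (hℓ : Λ.monodromy X T μ ^ ℓ = 1) :
    Λ.IsResonancePoint (ℓ * T) μ := by
  refine ⟨hμ, 1, ?_, ⟨1, 1, isUnit_one, by simp⟩, by simp [charpoly_one]⟩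
  rw [← hℓ, ← monodromy_nat_mul hclosed hX]
  exact isMonodromy_monodromy hX (ℓ * T) μ

theorem hasDerivAt_add_smul_lift (hX : IsLift Λ.L X) {p : V} (hmem : ∀ s, X s ∈ spaceForm p)
    (harc : ∀ s, Λ.q s = ip (deriv X s) (deriv X s)) (μ s : ℝ) :
    HasDerivAt (fun r => p + μ • X r) ((-μ • Λ.eta X) s *ᵥ (p + μ • X s)) s := by
  refine (((hX.hasDerivAt s).const_smul μ).const_add p).congr_deriv ?_
  rw [Pi.smul_apply, smul_mulVec, eta_eq_wedge harc, wedge_mulVec, ip_add_right, ip_add_right,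
    ip_smul_right, ip_smul_right, (hmem s).2, hX.ip_self, hX.ip_deriv_self,
    hX.ip_deriv_eq_zero hmem]
  simp

theorem monodromy_mulVec_add_smul_lift (hL : Function.Periodic Λ.L T) (hX : IsLift Λ.L X)
    {p : V} (hmem : ∀ s, X s ∈ spaceForm p)
    (harc : ∀ s, Λ.q s = ip (deriv X s) (deriv X s)) (μ : ℝ) :
    Λ.monodromy X T μ *ᵥ (p + μ • X 0) = p + μ • X 0 := by
  have h := peanoBaker_mulVec ((continuous_eta hX).const_smul (-μ))
    (hasDerivAt_add_smul_lift hX hmem harc μ) T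
  rwa [(hX.periodic_of_mem_spaceForm hmem hL).eq] at h

end PolarisedCurve

theorem ip_add_smul_self {p Y : V} (hY : Y ∈ spaceForm p) (μ : ℝ) :
    ip (p + μ • Y) (p + μ • Y) = ip p p - 2 * μ := by
  have hnull : ip Y Y = 0 := hY.1
  simp only [ip_add_left, ip_add_right, ip_smul_left, ip_smul_right, ip_comm p Y, hY.2, hnull]
  ring

end LightconeModel

open LightconeModel LightconeModel.PolarisedCurve in
theorem corollary4p3_general (Λ : PolarisedCurve) (T : ℝ) (hclosed : Λ.IsClosedWithPeriod T)
    (κ : ℝ) (p : V) (hp : ip p p = -κ) (X : ℝ → V) (hX : IsLift Λ.L X)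
    (hmem : ∀ s, X s ∈ spaceForm p) (harc : ∀ s, Λ.q s = ip (deriv X s) (deriv X s)) :
    ∃ μ : ℝ, -κ / 2 < μ ∧ ∃ ℓ : ℕ, 1 ≤ ℓ ∧ Λ.IsResonancePoint (ℓ * T) μ := by
  let f : ℝ → ℝ := fun μ => (Λ.monodromy X T μ).trace / 2 - 1
  have hf : AnalyticOnNhd ℝ f Set.univ :=
    ((analyticOnNhd_trace_monodromy hX T).div analyticOnNhd_const fun _ _ => two_ne_zero).sub
      analyticOnNhd_const
  have hf0 : f 0 = 1 := by norm_num [f, monodromy_zero]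
  have htimelike (μ : ℝ) (hμ : -κ / 2 < μ) : ip (p + μ • X 0) (p + μ • X 0) < 0 := by
    rw [ip_add_smul_self (hmem 0), hp]
    linarith
  have hiso := transpose_monodromy_mul_gram_mul hX T
  have hdet := det_monodromy hX T
  have hfix := monodromy_mulVec_add_smul_lift hclosed.1 hX hmem harc
  have hbound (μ : ℝ) (hμ : -κ / 2 < μ) : |f μ| ≤ 1 := by
    have h := abs_trace_sub_two_le_of_timelike_fixed (htimelike μ hμ) (hiso μ) (hdet μ) (hfix μ)
    simp only [f, abs_le] at h ⊢
    constructor <;> linarith [h.1, h.2]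
  obtain ⟨μ, hμ, r, hr⟩ := exists_eq_cos_rat_of_analyticOnNhd hf hf0
    (isOpen_Ioi (a := max (-κ / 2) 0)) isConnected_Ioi
    fun μ hμ => hbound μ (max_lt_iff.1 (Set.mem_Ioi.1 hμ)).1
  obtain ⟨hκ, h0⟩ := max_lt_iff.1 (Set.mem_Ioi.1 hμ)
  have htrace : (Λ.monodromy X T μ).trace = 2 + 2 * Real.cos (2 * Real.pi * r) := by
    linear_combination 2 * hr
  exact ⟨μ, hκ, r.den, r.pos, isResonancePoint_of_monodromy_pow_eq_one hclosed hX h0.ne'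
    (pow_den_eq_one_of_timelike_fixed (htimelike μ hκ) (hiso μ) (hdet μ) (hfix μ) htrace)⟩

theorem corollary4p3 (Λ : LightconeModel.PolarisedCurve) (T : ℝ) (hT : 0 < T)
    (hclosed : Λ.IsClosedWithPeriod T) (hfinite : Λ.IsFiniteType T)
    (κ : ℝ) (p : LightconeModel.V) (hp : LightconeModel.ip p p = -κ)
    (X : ℝ → LightconeModel.V) (hX : LightconeModel.IsLift Λ.L X)
    (helastic : LightconeModel.IsConstrainedElastic p T X)
    (harc : ∀ s, Λ.q s = LightconeModel.ip (deriv X s) (deriv X s)) :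
    ∃ μ : ℝ, -κ / 2 < μ ∧ ∃ ℓ : ℕ, 1 ≤ ℓ ∧ Λ.IsResonancePoint (ℓ * T) μ :=
  corollary4p3_general Λ T hclosed κ p hp X hX helastic.1.mem harc
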